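/- Let $X$ be a (real) Banach lattice. A vector $a\ge 0$ in $X$ is an atom if the ideal (solid linear subspace) generated by $a$ is one-dimensional; $X$ is atomic if for every non-zero $x\ge 0$ in $X$ there is an atom $a$ with $0\le a\le x$; and $X$ is a KB-space if every increasing norm bounded sequence of positive vectors in $X$ is norm convergent. The unbounded norm topology $\tau_{\mathrm{un}}$ on $X$ is the translation invariant (linear) topology for which the sets $$U_{u,\varepsilon}=\{y\in X:\ \|\,|y|\wedge u\,\|<\varepsilon\},\qquad u\ge 0,\ \varepsilon>0,$$ form a base of neighborhoods of zero. Theorem. If $X$ is an atomic KB-space, then $(X,\tau_{\mathrm{un}})$ is a paracompact topological space, that is, it is Hausdorff and every open cover admits a subordinate partition of unity (equivalently, it is Hausdorff and every open cover has a locally finite open refinement); and hence $(X,\tau_{\mathrm{un}})$ is a normal topological space. -/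

import Mathlib

open Set Filter Topology

section UnboundedNormTopology

/-- The ideal of a vector lattice generated by `A`: the smallest solid linear subspace
containing `A`. -/
def generatedIdeal {X : Type*} [AddCommGroup X] [Lattice X] [Module ℝ X] (A : Set X) :
    Submodule ℝ X :=
  sInf {I : Submodule ℝ X | LatticeOrderedAddCommGroup.IsSolid (I : Set X) ∧ A ⊆ I}

/-- An atom is a positive vector whose principal ideal is one-dimensional
(in particular it is non-zero). -/
def IsLatticeAtom {X : Type*} [AddCommGroup X] [Lattice X] [Module ℝ X] (a : X) : Prop :=
  0 ≤ a ∧ Module.finrank ℝ (generatedIdeal {a}) = 1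

/-- A vector lattice is atomic if every non-zero positive vector dominates an atom. -/
def IsAtomicLattice (X : Type*) [AddCommGroup X] [Lattice X] [Module ℝ X] : Prop :=
  ∀ x : X, 0 ≤ x → x ≠ 0 → ∃ a : X, IsLatticeAtom a ∧ a ≤ x

/-- The defining property of KB-spaces among Banach lattices: every increasing norm bounded
sequence of positive vectors is norm convergent. -/
def IsKBSpace (X : Type*) [NormedAddCommGroup X] [Lattice X] : Prop :=
  ∀ x : ℕ → X, (∀ n, 0 ≤ x n) → Monotone x → (∃ C : ℝ, ∀ n, ‖x n‖ ≤ C) →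
    ∃ l : X, Tendsto x atTop (𝓝 l)

/-- The set `{y : ‖|y| ∧ u‖ < ε}`. -/
def unBall {X : Type*} [NormedAddCommGroup X] [Lattice X] (u : X) (ε : ℝ) : Set X :=
  {y | ‖|y| ⊓ u‖ < ε}

variable (X : Type*) [NormedAddCommGroup X] [Lattice X] [HasSolidNorm X] [IsOrderedAddMonoid X]

variable {X} in
theorem norm_abs_inf_le_of_le {y z u v : X} (hu : 0 ≤ u) (hyz : |y| ≤ |z|) (huv : u ≤ v) :
    ‖|y| ⊓ u‖ ≤ ‖|z| ⊓ v‖ := by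
  have h0 : 0 ≤ |y| ⊓ u := le_inf (abs_nonneg y) hu
  have h1 : |y| ⊓ u ≤ |z| ⊓ v := inf_le_inf hyz huv
  apply norm_le_norm_of_abs_le_abs
  rwa [abs_of_nonneg h0, abs_of_nonneg (h0.trans h1)]

variable {X} in
theorem norm_abs_add_inf_le {y z u : X} (hu : 0 ≤ u) :
    ‖|y + z| ⊓ u‖ ≤ ‖|y| ⊓ u‖ + ‖|z| ⊓ u‖ := by
  have h0 : 0 ≤ |y + z| ⊓ u := le_inf (abs_nonneg _) hu
  have hy : 0 ≤ |y| ⊓ u := le_inf (abs_nonneg _) hu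
  have hz : 0 ≤ |z| ⊓ u := le_inf (abs_nonneg _) hu
  have h1 : |y + z| ⊓ u ≤ |y| ⊓ u + |z| ⊓ u := by
    rw [inf_add, add_inf, add_inf]
    refine le_inf (le_inf ?_ ?_) (le_inf ?_ ?_)
    · exact inf_le_left.trans (abs_add_le y z)
    · exact inf_le_right.trans (le_add_of_nonneg_left (abs_nonneg y))
    · exact inf_le_right.trans (le_add_of_nonneg_right (abs_nonneg z))
    · exact inf_le_right.trans (le_add_of_nonneg_right hu)
  refine le_trans ?_ (norm_add_le _ _)
  apply norm_le_norm_of_abs_le_abs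
  rwa [abs_of_nonneg h0, abs_of_nonneg (h0.trans h1)]

/-- The sets `{y : ‖|y| ∧ u‖ < ε}` with `u ≥ 0` and `ε > 0`, as a base of neighbourhoods of zero
of an additive group topology. -/
@[reducible]
def unFilterBasis : AddGroupFilterBasis X where
  sets := {V | ∃ (u : X) (ε : ℝ), 0 ≤ u ∧ 0 < ε ∧ V = unBall u ε}
  nonempty := ⟨_, 0, 1, le_rfl, one_pos, rfl⟩
  inter_sets := by
    rintro _ _ ⟨u, ε, hu, hε, rfl⟩ ⟨v, δ, hv, hδ, rfl⟩
    refine ⟨_, ⟨u ⊔ v, min ε δ, hu.trans le_sup_left, lt_min hε hδ, rfl⟩, fun y hy => ⟨?_, ?_⟩⟩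
    · exact (norm_abs_inf_le_of_le hu le_rfl le_sup_left).trans_lt
        (lt_of_lt_of_le hy (min_le_left _ _))
    · exact (norm_abs_inf_le_of_le hv le_rfl le_sup_right).trans_lt
        (lt_of_lt_of_le hy (min_le_right _ _))
  zero' := by
    rintro _ ⟨u, ε, hu, hε, rfl⟩
    simpa [unBall, inf_eq_left.2 hu] using hε
  add' := by
    rintro _ ⟨u, ε, hu, hε, rfl⟩
    refine ⟨_, ⟨u, ε / 2, hu, half_pos hε, rfl⟩, ?_⟩
    rintro _ ⟨y, hy, z, hz, rfl⟩
    exact (norm_abs_add_inf_le hu).trans_lt ((add_lt_add hy hz).trans_eq (add_halves ε))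
  neg' := by
    rintro _ ⟨u, ε, hu, hε, rfl⟩
    refine ⟨_, ⟨u, ε, hu, hε, rfl⟩, fun y hy => ?_⟩
    simpa [unBall] using hy
  conj' := by
    rintro x _ ⟨u, ε, hu, hε, rfl⟩
    exact ⟨_, ⟨u, ε, hu, hε, rfl⟩, fun y hy => by simpa using hy⟩

/-- The unbounded norm topology on a normed lattice: the translation invariant topology for which
the sets `{y : ‖|y| ∧ u‖ < ε}`, `u ≥ 0`, `ε > 0`, form a base of neighbourhoods of zero. -/
@[reducible]
def unTopology : TopologicalSpace X := (unFilterBasis X).topology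

/-- A copy of `X`, to be equipped with the unbounded norm topology instead of the norm topology. -/
def UnSpace (X : Type*) : Type _ := X

instance UnSpace.instTopologicalSpace : TopologicalSpace (UnSpace X) := unTopology X

end UnboundedNormTopology

/-! The un-topology turns the positive part of every norm ball into a compact set
(`Ultrafilter.exists_le_nhds_unTopology`). Along an ultrafilter on it, the coordinates at the
norm-one atoms converge; the KB property sums the limiting coordinates to a vector `y`.
Un-convergence to `y` need only be tested against finite combinations of atoms, since these
approximate every `u ≥ 0` in norm (`hasSum_atomCoord_smul`), and at a single atom it is convergence
of the coordinate (`abs_sub_inf_smul_le`). As `x = x⁺ - x⁻`, the space is σ-compact, hence Lindelöf.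
A topological group is regular, and regular Lindelöf spaces are paracompact; with Hausdorffness this
yields normality and partitions of unity. -/

theorem paracompactSpace_of_regularSpace_of_lindelofSpace (Y : Type*) [TopologicalSpace Y]
    [RegularSpace Y] [LindelofSpace Y] : ParacompactSpace Y where
  locallyFinite_refinement α s ho hu := by
    cases isEmpty_or_nonempty Y
    · exact ⟨α, s, ho, hu, fun x => isEmptyElim x, fun b => ⟨b, le_rfl⟩⟩
    have h (x : Y) : ∃ (a : α) (W : Set Y), IsOpen W ∧ x ∈ W ∧ closure W ⊆ s a := by
      obtain ⟨a, ha⟩ := iUnion_eq_univ_iff.1 hu x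
      obtain ⟨t, ht, hct, hts⟩ := exists_mem_nhds_isClosed_subset ((ho a).mem_nhds ha)
      exact ⟨a, interior t, isOpen_interior, mem_interior_iff_mem_nhds.2 ht,
        (closure_minimal interior_subset hct).trans hts⟩
    choose a W hWo hxW hWs using h
    obtain ⟨p, hp⟩ := isLindelof_univ.indexed_countable_subcover W hWo
      fun x _ => mem_iUnion.2 ⟨x, hxW x⟩
    have hcov (x : Y) : ∃ n : ℕ, x ∈ W (p n) := mem_iUnion.1 (hp (mem_univ x))
    -- The `n`-th set discards the closures of the earlier `W (p m)`, so it misses `W (p k)` once `n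
    -- > k`: this gives local finiteness.
    refine ⟨ULift ℕ, fun n => s (a (p n.down)) \ ⋃ m ∈ Finset.range n.down, closure (W (p m)),
      fun n => (ho _).sdiff (isClosed_biUnion_finset fun _ _ => isClosed_closure), ?_, ?_,
      fun n => ⟨_, sdiff_subset⟩⟩
    · refine iUnion_eq_univ_iff.2 fun x => ?_
      classical
      have hx : ∃ n : ℕ, x ∈ s (a (p n)) :=
        (hcov x).imp fun n hn => hWs _ (subset_closure hn)
      refine ⟨⟨Nat.find hx⟩, Nat.find_spec hx, ?_⟩
      simp only [mem_iUnion, Finset.mem_range, not_exists]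
      exact fun m hm hxm => Nat.find_min hx hm (hWs _ hxm)
    · intro x
      obtain ⟨k, hk⟩ := hcov x
      refine ⟨W (p k), (hWo _).mem_nhds hk, ?_⟩
      refine ((Set.finite_Iic k).preimage ULift.down_injective.injOn).subset ?_
      rintro ⟨n⟩ ⟨y, ⟨-, hy⟩, hyk⟩
      simp only [mem_preimage, mem_Iic]
      by_contra! hkn
      exact hy (mem_iUnion₂.2 ⟨k, Finset.mem_range.2 hkn, subset_closure hyk⟩)

/-! ### Disjointness in vector lattices -/

section LatticeOrderedGroup

variable {X : Type*} [AddCommGroup X] [Lattice X] [IsOrderedAddMonoid X]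

theorem add_inf_le_inf_add_inf {u v w : X} (hu : 0 ≤ u) (hv : 0 ≤ v) (hw : 0 ≤ w) :
    (u + v) ⊓ w ≤ u ⊓ w + v ⊓ w := by
  rw [inf_add, add_inf, add_inf]
  exact le_inf (le_inf inf_le_left (inf_le_right.trans (le_add_of_nonneg_left hu)))
    (le_inf (inf_le_right.trans (le_add_of_nonneg_right hv))
      (inf_le_right.trans (le_add_of_nonneg_right hw)))

theorem add_inf_eq_zero {u v w : X} (hu : 0 ≤ u) (hv : 0 ≤ v) (hw : 0 ≤ w)
    (huw : u ⊓ w = 0) (hvw : v ⊓ w = 0) : (u + v) ⊓ w = 0 :=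
  le_antisymm ((add_inf_le_inf_add_inf hu hv hw).trans (by simp [huw, hvw]))
    (le_inf (add_nonneg hu hv) hw)

theorem sum_inf_le_sum_inf {ι : Type*} {f : ι → X} {w : X} (hf : ∀ i, 0 ≤ f i) (hw : 0 ≤ w)
    (s : Finset ι) : (∑ i ∈ s, f i) ⊓ w ≤ ∑ i ∈ s, f i ⊓ w := by
  classical
  induction s using Finset.induction_on with
  | empty => simp
  | insert i s hi ih =>
    rw [Finset.sum_insert hi, Finset.sum_insert hi]
    exact (add_inf_le_inf_add_inf (hf i) (Finset.sum_nonneg fun j _ => hf j) hw).trans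
      (by gcongr)

theorem sum_inf_eq_zero {ι : Type*} {f : ι → X} {w : X} {s : Finset ι} (hf : ∀ i, 0 ≤ f i)
    (hw : 0 ≤ w) (h : ∀ i ∈ s, f i ⊓ w = 0) : (∑ i ∈ s, f i) ⊓ w = 0 :=
  le_antisymm ((sum_inf_le_sum_inf hf hw s).trans (Finset.sum_eq_zero h).le)
    (le_inf (Finset.sum_nonneg fun i _ => hf i) hw)

theorem add_le_of_inf_eq_zero {u v x : X} (huv : u ⊓ v = 0) (hu : u ≤ x) (hv : v ≤ x) :
    u + v ≤ x := by
  rw [← inf_add_sup, huv, zero_add]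
  exact sup_le hu hv

theorem sum_le_of_pairwise_inf_eq_zero {ι : Type*} {f : ι → X} {x : X} (hf : ∀ i, 0 ≤ f i)
    (hd : Pairwise fun i j => f i ⊓ f j = 0) (hx : 0 ≤ x) (h : ∀ i, f i ≤ x) (s : Finset ι) :
    ∑ i ∈ s, f i ≤ x := by
  classical
  induction s using Finset.induction_on with
  | empty => simpa
  | insert i s hi ih =>
    rw [Finset.sum_insert hi, add_comm]
    exact add_le_of_inf_eq_zero
      (sum_inf_eq_zero hf (hf i) fun j hj => hd (ne_of_mem_of_not_mem hj hi)) ih (h i)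

theorem smul_inf_eq_zero [Module ℝ X] [IsOrderedModule ℝ X] {u w : X} {t : ℝ} (hu : 0 ≤ u)
    (hw : 0 ≤ w) (ht : 0 ≤ t) (h : u ⊓ w = 0) : (t • u) ⊓ w = 0 := by
  obtain ⟨n, hn⟩ := exists_nat_ge t
  -- An integer multiple is a sum of copies of `u`, each disjoint from `w`.
  have hnu : ((n : ℝ) • u) ⊓ w = 0 := by
    have := sum_inf_eq_zero (s := Finset.range n) (f := fun _ => u) (fun _ => hu) hw fun _ _ => h
    rwa [Finset.sum_const, Finset.card_range, ← Nat.cast_smul_eq_nsmul ℝ] at this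
  refine le_antisymm ?_ (le_inf (smul_nonneg ht hu) hw)
  rw [← hnu]
  exact inf_le_inf_right _ (smul_le_smul_of_nonneg_right hn hu)

/-- Both remainders are disjoint from `a`, so truncation by `k • a` leaves only the difference of
the components along `a`. -/
theorem abs_sub_inf_smul_le [Module ℝ X] [IsOrderedModule ℝ X] {a x y : X} {s t k : ℝ}
    (ha : 0 ≤ a) (hk : 0 ≤ k) (hx : 0 ≤ x - s • a) (hxa : (x - s • a) ⊓ a = 0)
    (hy : 0 ≤ y - t • a) (hya : (y - t • a) ⊓ a = 0) :
    |x - y| ⊓ (k • a) ≤ |s - t| • a := by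
  have hst : 0 ≤ |s - t| • a := smul_nonneg (abs_nonneg _) ha
  have hka : 0 ≤ k • a := smul_nonneg hk ha
  have h1 : |x - y| ≤ |s - t| • a + ((x - s • a) + (y - t • a)) := by
    have e : x - y = (s - t) • a + ((x - s • a) - (y - t • a)) := by rw [sub_smul]; abel
    have e1 : |(s - t) • a| ≤ |s - t| • a := by
      refine abs_le'.2 ⟨smul_le_smul_of_nonneg_right (le_abs_self _) ha, ?_⟩
      rw [← neg_smul]
      exact smul_le_smul_of_nonneg_right (neg_le_abs _) ha
    have e2 : |(x - s • a) - (y - t • a)| ≤ (x - s • a) + (y - t • a) := by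
      refine abs_le'.2 ⟨?_, ?_⟩
      · rw [sub_eq_add_neg]
        gcongr
        exact (neg_nonpos.2 hy).trans hy
      · rw [neg_sub, add_comm, sub_eq_add_neg]
        gcongr
        exact (neg_nonpos.2 hx).trans hx
    rw [e]
    exact (abs_add_le _ _).trans (add_le_add e1 e2)
  have h2 : ((x - s • a) + (y - t • a)) ⊓ (k • a) = 0 := by
    rw [inf_comm]
    exact smul_inf_eq_zero ha (add_nonneg hx hy) hk
      (by rw [inf_comm]; exact add_inf_eq_zero hx hy ha hxa hya)
  calc |x - y| ⊓ (k • a) ≤ (|s - t| • a + ((x - s • a) + (y - t • a))) ⊓ (k • a) :=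
        inf_le_inf_right _ h1
    _ ≤ (|s - t| • a) ⊓ (k • a) + ((x - s • a) + (y - t • a)) ⊓ (k • a) :=
        add_inf_le_inf_add_inf hst (add_nonneg hx hy) hka
    _ ≤ |s - t| • a := by rw [h2, add_zero]; exact inf_le_left

end LatticeOrderedGroup

/-! ### Atoms and principal ideals -/

section Atoms

theorem isSolid_generatedIdeal {X : Type*} [AddCommGroup X] [Lattice X] [Module ℝ X] (A : Set X) :
    LatticeOrderedAddCommGroup.IsSolid (generatedIdeal A : Set X) := by
  intro x hx y hyx
  simp only [generatedIdeal, SetLike.mem_coe, Submodule.mem_sInf] at hx ⊢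
  exact fun I hI => hI.1 (hx I hI) hyx

theorem subset_generatedIdeal {X : Type*} [AddCommGroup X] [Lattice X] [Module ℝ X] (A : Set X) :
    A ⊆ generatedIdeal A := fun x hx => by
  simp only [generatedIdeal, SetLike.mem_coe, Submodule.mem_sInf]
  exact fun I hI => hI.2 hx

variable {X : Type*} [AddCommGroup X] [Lattice X] [Module ℝ X] [IsOrderedAddMonoid X]

theorem IsLatticeAtom.ne_zero {a : X} (ha : IsLatticeAtom a) : a ≠ 0 := by
  rintro rfl
  have h : generatedIdeal {(0 : X)} = ⊥ := by
    refine le_bot_iff.1 (sInf_le ⟨?_, by simp⟩)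
    intro x hx y hyx
    simp only [Submodule.bot_coe, mem_singleton_iff] at hx ⊢
    subst hx
    rw [abs_zero] at hyx
    exact le_antisymm ((le_abs_self y).trans hyx) (neg_nonpos.1 ((neg_le_abs y).trans hyx))
  have h1 := ha.2
  rw [h, finrank_bot] at h1
  exact zero_ne_one h1

theorem IsLatticeAtom.exists_eq_smul {a z : X} (ha : IsLatticeAtom a) (hz : 0 ≤ z) (hza : z ≤ a) :
    ∃ s : ℝ, z = s • a := by
  have hmem : a ∈ generatedIdeal {a} := subset_generatedIdeal _ rfl
  have hzm : z ∈ generatedIdeal {a} := isSolid_generatedIdeal {a} hmem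
    (by rwa [abs_of_nonneg hz, abs_of_nonneg ha.1])
  obtain ⟨s, hs⟩ := exists_smul_eq_of_finrank_eq_one ha.2
    (x := (⟨a, hmem⟩ : generatedIdeal {a})) (by simpa using ha.ne_zero) ⟨z, hzm⟩
  exact ⟨s, by simpa using congrArg Subtype.val hs.symm⟩

omit [IsOrderedAddMonoid X] in
theorem IsLatticeAtom.smul [IsOrderedModule ℝ X] {a : X} (ha : IsLatticeAtom a) {t : ℝ}
    (ht : 0 < t) : IsLatticeAtom (t • a) := by
  refine ⟨smul_nonneg ht.le ha.1, ?_⟩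
  have : generatedIdeal {t • a} = generatedIdeal {a} := by
    unfold generatedIdeal
    congr 1
    ext I
    simp only [singleton_subset_iff, SetLike.mem_coe, mem_ofPred_eq]
    rw [I.smul_mem_iff ht.ne']
  rw [this, ha.2]

end Atoms

/-! ### Coordinates and expansions along norm-one atoms -/

section NormedLattice

variable {X : Type*} [NormedAddCommGroup X] [Lattice X] [IsOrderedAddMonoid X] [HasSolidNorm X]

theorem norm_le_norm_of_nonneg_of_le {x y : X} (hx : 0 ≤ x) (hxy : x ≤ y) : ‖x‖ ≤ ‖y‖ :=
  norm_le_norm_of_abs_le_abs (by rwa [abs_of_nonneg hx, abs_of_nonneg (hx.trans hxy)])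

omit [HasSolidNorm X] in
theorem IsKBSpace.summable [CompleteSpace X] (hKB : IsKBSpace X) {ι : Type*} {f : ι → X}
    (hf : ∀ i, 0 ≤ f i) {C : ℝ} (hC : ∀ s : Finset ι, ‖∑ i ∈ s, f i‖ ≤ C) : Summable f := by
  classical
  rw [summable_iff_vanishing_norm]
  by_contra! h
  obtain ⟨ε, hε, h⟩ := h
  -- Adjoining `t s` to `s` repeatedly gives increasing bounded partial sums with all increments of
  -- norm at least `ε`, so they cannot converge.
  choose t htd ht using h
  let S : ℕ → Finset ι := fun n => Nat.rec ∅ (fun _ s => s ∪ t s) n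
  have hS (n : ℕ) : ∑ i ∈ S (n + 1), f i = ∑ i ∈ S n, f i + ∑ i ∈ t (S n), f i :=
    Finset.sum_union (htd (S n)).symm
  obtain ⟨l, hl⟩ := hKB (fun n => ∑ i ∈ S n, f i) (fun n => Finset.sum_nonneg fun i _ => hf i)
    (monotone_nat_of_le_succ fun n => by
      rw [hS]; exact le_add_of_nonneg_right (Finset.sum_nonneg fun i _ => hf i))
    ⟨C, fun n => hC _⟩
  have h0 : Tendsto (fun n => ‖∑ i ∈ t (S n), f i‖) atTop (𝓝 0) := by
    have := ((hl.comp (tendsto_add_atTop_nat 1)).sub hl).norm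
    simpa [Function.comp_def, hS] using this
  obtain ⟨n, hn⟩ := (h0.eventually_lt_const hε).exists
  exact (ht (S n)).not_gt hn

variable [NormedSpace ℝ X]

/-- The atoms of norm one. -/
def unitAtoms (X : Type*) [NormedAddCommGroup X] [Lattice X] [NormedSpace ℝ X] : Set X :=
  {a | IsLatticeAtom a ∧ ‖a‖ = 1}

omit [IsOrderedAddMonoid X] [HasSolidNorm X] in
theorem unitAtoms_nonneg (a : unitAtoms X) : 0 ≤ (a : X) := a.2.1.1

omit [HasSolidNorm X] in
-- A non-zero infimum would be a multiple of both atoms, forcing `a = ±b`; positivity excludes the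
-- minus sign.
theorem inf_eq_zero_of_mem_unitAtoms {a b : X} (ha : a ∈ unitAtoms X) (hb : b ∈ unitAtoms X)
    (hab : a ≠ b) : a ⊓ b = 0 := by
  by_contra hz
  have h0 : 0 ≤ a ⊓ b := le_inf ha.1.1 hb.1.1
  obtain ⟨s, hs⟩ := ha.1.exists_eq_smul h0 inf_le_left
  obtain ⟨t, ht⟩ := hb.1.exists_eq_smul h0 inf_le_right
  have hst : |s| = |t| := by
    have := congrArg norm (hs.symm.trans ht)
    simpa [norm_smul, ha.2, hb.2] using this
  have hs0 : s ≠ 0 := by rintro rfl; exact hz (by simpa using hs)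
  rcases abs_eq_abs.1 hst with rfl | rfl
  · exact hab (smul_right_injective X hs0 (hs.symm.trans ht))
  · have h1 : a = -b := by
      have ht0 : t ≠ 0 := by simpa using hs0
      refine smul_right_injective X hs0 ?_
      simpa using hs.symm.trans ht
    have h2 : a ≤ 0 := by rw [h1]; exact neg_nonpos.2 hb.1.1
    exact ha.1.ne_zero (h2.antisymm ha.1.1)

variable [IsOrderedModule ℝ X]

/-- Take the largest `t` with `t • a ≤ x`: a positive multiple of `a` still below the remainder
would contradict maximality. -/
theorem exists_smul_le_and_sub_inf_eq_zero {a x : X} (ha : a ∈ unitAtoms X) (hx : 0 ≤ x) :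
    ∃ t : ℝ, 0 ≤ t ∧ t • a ≤ x ∧ (x - t • a) ⊓ a = 0 := by
  have hcomp : IsCompact {t : ℝ | 0 ≤ t ∧ t • a ≤ x} := by
    refine (isCompact_Icc (a := (0 : ℝ)) (b := ‖x‖)).of_isClosed_subset ?_ ?_
    · exact (isClosed_le continuous_const continuous_id).inter
        (isClosed_le (continuous_id.smul continuous_const) continuous_const)
    · rintro t ⟨ht, htx⟩
      refine ⟨ht, ?_⟩
      have := norm_le_norm_of_nonneg_of_le (smul_nonneg ht ha.1.1) htx
      rwa [norm_smul, ha.2, mul_one, Real.norm_of_nonneg ht] at this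
  obtain ⟨t, ⟨ht, htx⟩, hmax⟩ := hcomp.exists_isGreatest ⟨0, le_rfl, by simpa using hx⟩
  refine ⟨t, ht, htx, ?_⟩
  have h0 : 0 ≤ (x - t • a) ⊓ a := le_inf (sub_nonneg.2 htx) ha.1.1
  obtain ⟨s, hs⟩ := ha.1.exists_eq_smul h0 inf_le_right
  rcases le_or_gt s 0 with hs0 | hs0
  · refine le_antisymm ?_ h0
    rw [hs]
    exact smul_nonpos_of_nonpos_of_nonneg hs0 ha.1.1
  · have h1 : s • a ≤ x - t • a := hs ▸ inf_le_left
    have h2 : t + s ≤ t := hmax ⟨by positivity, by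
      rw [add_smul, add_comm]; exact le_sub_iff_add_le.1 h1⟩
    linarith

/-- The coordinate of a positive vector at an atom of norm one. -/
noncomputable def atomCoord (a : unitAtoms X) (x : X) : ℝ :=
  open Classical in
  if hx : 0 ≤ x then (exists_smul_le_and_sub_inf_eq_zero a.2 hx).choose else 0

theorem atomCoord_spec (a : unitAtoms X) {x : X} (hx : 0 ≤ x) :
    0 ≤ atomCoord a x ∧ atomCoord a x • (a : X) ≤ x ∧
      (x - atomCoord a x • (a : X)) ⊓ a = 0 := by
  rw [atomCoord, dif_pos hx]
  exact (exists_smul_le_and_sub_inf_eq_zero a.2 hx).choose_spec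

theorem atomCoord_le_norm (a : unitAtoms X) {x : X} (hx : 0 ≤ x) : atomCoord a x ≤ ‖x‖ := by
  obtain ⟨h0, h1, -⟩ := atomCoord_spec a hx
  have := norm_le_norm_of_nonneg_of_le (smul_nonneg h0 (unitAtoms_nonneg a)) h1
  rwa [norm_smul, a.2.2, mul_one, Real.norm_of_nonneg h0] at this

omit [HasSolidNorm X] in
theorem smul_inf_smul_eq_zero_of_unitAtoms {f : unitAtoms X → ℝ} (hf : ∀ a, 0 ≤ f a) :
    Pairwise fun a b : unitAtoms X => (f a • (a : X)) ⊓ (f b • (b : X)) = 0 := by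
  intro a b hab
  have ha := unitAtoms_nonneg a
  have hb := unitAtoms_nonneg b
  refine smul_inf_eq_zero ha (smul_nonneg (hf b) hb) (hf a) ?_
  rw [inf_comm]
  refine smul_inf_eq_zero hb ha (hf b) ?_
  exact inf_eq_zero_of_mem_unitAtoms b.2 a.2 fun h => hab (Subtype.ext h.symm)

theorem sum_atomCoord_smul_le {x : X} (hx : 0 ≤ x) (s : Finset (unitAtoms X)) :
    ∑ a ∈ s, atomCoord a x • (a : X) ≤ x :=
  sum_le_of_pairwise_inf_eq_zero
    (fun a => smul_nonneg (atomCoord_spec a hx).1 (unitAtoms_nonneg a))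
    (smul_inf_smul_eq_zero_of_unitAtoms fun a => (atomCoord_spec a hx).1) hx
    (fun a => (atomCoord_spec a hx).2.1) s

/-- Disjointness from `b` holds for every partial sum containing the index `b` and survives the
limit, so `f b` acts as the coordinate of `y` at `b`. -/
theorem HasSum.sub_smul_inf_unitAtom_eq_zero {f : unitAtoms X → ℝ} (hf : ∀ a, 0 ≤ f a) {y : X}
    (hy : HasSum (fun a : unitAtoms X => f a • (a : X)) y) (b : unitAtoms X) :
    (y - f b • (b : X)) ⊓ b = 0 := by
  classical
  have hlim := (hy.sub_const (f b • (b : X))).inf_nhds (tendsto_const_nhds (x := (b : X)))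
  refine tendsto_nhds_unique hlim (tendsto_const_nhds.congr' ?_)
  filter_upwards [eventually_ge_atTop {b}] with s hs
  have hbs : b ∈ s := Finset.singleton_subset_iff.1 hs
  rw [← Finset.add_sum_erase s _ hbs, add_sub_cancel_left]
  refine (sum_inf_eq_zero (fun a => smul_nonneg (hf a) (unitAtoms_nonneg a))
    (unitAtoms_nonneg b) fun a ha => ?_).symm
  refine smul_inf_eq_zero (unitAtoms_nonneg a) (unitAtoms_nonneg b) (hf a) ?_
  exact inf_eq_zero_of_mem_unitAtoms a.2 b.2 fun h => Finset.ne_of_mem_erase ha (Subtype.ext h)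

theorem hasSum_atomCoord_smul [CompleteSpace X] (hatomic : IsAtomicLattice X)
    (hKB : IsKBSpace X) {x : X} (hx : 0 ≤ x) :
    HasSum (fun a : unitAtoms X => atomCoord a x • (a : X)) x := by
  have hnn (a : unitAtoms X) : 0 ≤ atomCoord a x • (a : X) :=
    smul_nonneg (atomCoord_spec a hx).1 (unitAtoms_nonneg a)
  have hsum : Summable fun a : unitAtoms X => atomCoord a x • (a : X) :=
    hKB.summable hnn fun s =>
      norm_le_norm_of_nonneg_of_le (Finset.sum_nonneg fun a _ => hnn a)
        (sum_atomCoord_smul_le hx s)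
  obtain ⟨y, hy⟩ := hsum
  have hyx : y ≤ x := le_of_tendsto' hy fun s => sum_atomCoord_smul_le hx s
  suffices x - y = 0 by rwa [← sub_eq_zero.1 this] at hy
  by_contra hne
  -- An atom below the defect `x - y`, once normalised to `b`, would lie below a remainder disjoint
  -- from `b`.
  obtain ⟨a, ha, hax⟩ := hatomic _ (sub_nonneg.2 hyx) hne
  have hna : 0 < ‖a‖ := norm_pos_iff.2 ha.ne_zero
  let b : unitAtoms X := ⟨‖a‖⁻¹ • a, ha.smul (inv_pos.2 hna), by
    rw [norm_smul, norm_inv, norm_norm, inv_mul_cancel₀ hna.ne']⟩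
  have hab : a = ‖a‖ • (b : X) := (smul_inv_smul₀ hna.ne' a).symm
  obtain ⟨-, h1, h2⟩ := atomCoord_spec b hx
  have h3 : a ≤ x - atomCoord b x • (b : X) :=
    hax.trans (sub_le_sub_left (le_hasSum hy b fun c _ => hnn c) x)
  have h4 : (‖a‖ • (b : X)) ⊓ (x - atomCoord b x • (b : X)) = 0 :=
    smul_inf_eq_zero (unitAtoms_nonneg b) (sub_nonneg.2 h1) hna.le (by rwa [inf_comm])
  rw [← hab, inf_eq_left.2 h3] at h4
  exact ha.ne_zero h4

end NormedLattice

/-! ### Compactness in the un-topology -/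

section UnSpace

variable {X : Type*} [NormedAddCommGroup X] [Lattice X] [IsOrderedAddMonoid X] [HasSolidNorm X]

instance UnSpace.instAddCommGroup : AddCommGroup (UnSpace X) := inferInstanceAs (AddCommGroup X)

instance UnSpace.instIsTopologicalAddGroup : IsTopologicalAddGroup (UnSpace X) :=
  (unFilterBasis X).isTopologicalAddGroup

theorem le_nhds_unTopology_iff {F : Filter X} {y : X} :
    F ≤ @nhds X (unTopology X) y ↔
      ∀ (u : X) (ε : ℝ), 0 ≤ u → 0 < ε → ∀ᶠ x in F, ‖|x - y| ⊓ u‖ < ε := by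
  rw [((unFilterBasis X).nhds_hasBasis y).ge_iff]
  constructor
  · intro h u ε hu hε
    filter_upwards [h _ ⟨u, ε, hu, hε, rfl⟩]
    rintro _ ⟨z, hz, rfl⟩
    simpa [unBall] using hz
  · rintro h _ ⟨u, ε, hu, hε, rfl⟩
    filter_upwards [h u ε hu hε] with x hx
    exact ⟨x - y, hx, add_sub_cancel y x⟩

theorem t2Space_unTopology : @T2Space X (unTopology X) := by
  refine (@AddGroupFilterBasis.t2Space_iff_sInter_subset X _ (unTopology X)
    (unFilterBasis X) rfl).2 fun y hy => ?_
  by_contra hne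
  -- This neighbourhood excludes `y`, because `|y| ⊓ |y|` has norm exactly `‖y‖`.
  have h := mem_sInter.1 hy _ ⟨|y|, ‖y‖, abs_nonneg y, norm_pos_iff.2 hne, rfl⟩
  simp [unBall, norm_abs_eq_norm] at h

variable [NormedSpace ℝ X] [IsOrderedModule ℝ X] [CompleteSpace X]

theorem Ultrafilter.exists_le_nhds_unTopology (hatomic : IsAtomicLattice X) (hKB : IsKBSpace X)
    {C : ℝ} {F : Ultrafilter X} (hF : {x : X | 0 ≤ x ∧ ‖x‖ ≤ C} ∈ F) :
    ∃ y ∈ {x : X | 0 ≤ x ∧ ‖x‖ ≤ C}, (F : Filter X) ≤ @nhds X (unTopology X) y := by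
  have hlim (a : unitAtoms X) : ∃ l ∈ Icc 0 C, Tendsto (fun x : X => atomCoord a x) F (𝓝 l) := by
    refine isCompact_Icc.ultrafilter_le_nhds (F.map fun x : X => atomCoord a x) ?_
    rw [le_principal_iff, Ultrafilter.coe_map, Filter.mem_map]
    refine mem_of_superset hF fun x hx => ?_
    exact ⟨(atomCoord_spec a hx.1).1, (atomCoord_le_norm a hx.1).trans hx.2⟩
  choose f hfC hf using hlim
  have hf0 (a : unitAtoms X) : 0 ≤ f a := (hfC a).1
  have hnn (a : unitAtoms X) : 0 ≤ f a • (a : X) := smul_nonneg (hf0 a) (unitAtoms_nonneg a)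
  have hbound (s : Finset (unitAtoms X)) : ‖∑ a ∈ s, f a • (a : X)‖ ≤ C := by
    have ht : Tendsto (fun x : X => ‖∑ a ∈ s, atomCoord a x • (a : X)‖) F
        (𝓝 ‖∑ a ∈ s, f a • (a : X)‖) :=
      (tendsto_finsetSum s fun a _ => (hf a).smul_const (a : X)).norm
    refine le_of_tendsto ht ?_
    filter_upwards [hF] with x hx
    exact (norm_le_norm_of_nonneg_of_le (Finset.sum_nonneg fun a _ =>
      smul_nonneg (atomCoord_spec a hx.1).1 (unitAtoms_nonneg a))
      (sum_atomCoord_smul_le hx.1 s)).trans hx.2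
  obtain ⟨y, hy⟩ := hKB.summable hnn hbound
  refine ⟨y, ⟨hy.nonneg hnn, le_of_tendsto' hy.norm hbound⟩, le_nhds_unTopology_iff.2 ?_⟩
  intro u ε hu hε
  have hus := hasSum_atomCoord_smul hatomic hKB hu
  obtain ⟨s, hs⟩ : ∃ s : Finset (unitAtoms X),
      ‖u - ∑ a ∈ s, atomCoord a u • (a : X)‖ < ε / 2 := by
    have : Tendsto (fun s : Finset (unitAtoms X) => ‖u - ∑ a ∈ s, atomCoord a u • (a : X)‖)
        atTop (𝓝 0) := by simpa using (hus.const_sub u).norm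
    exact (this.eventually_lt_const (half_pos hε)).exists
  have hcoord : ∀ᶠ x : X in F, ∑ a ∈ s, |atomCoord a x - f a| < ε / 2 := by
    have : Tendsto (fun x : X => ∑ a ∈ s, |atomCoord a x - f a|) F (𝓝 0) := by
      simpa using tendsto_finsetSum s fun a _ => ((hf a).sub_const (f a)).abs
    exact this.eventually_lt_const (half_pos hε)
  filter_upwards [hF, hcoord] with x hx hxs
  have hunn (a : unitAtoms X) : 0 ≤ atomCoord a u • (a : X) :=
    smul_nonneg (atomCoord_spec a hu).1 (unitAtoms_nonneg a)
  -- Split `u` into a finite atomic part, controlled by the coordinates, and a tail of norm below `ε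
  -- / 2`.
  have key : |x - y| ⊓ u ≤ ∑ a ∈ s, |atomCoord a x - f a| • (a : X) +
      (u - ∑ a ∈ s, atomCoord a u • (a : X)) := by
    have hr : 0 ≤ u - ∑ a ∈ s, atomCoord a u • (a : X) :=
      sub_nonneg.2 (sum_atomCoord_smul_le hu s)
    calc |x - y| ⊓ u
        = (∑ a ∈ s, atomCoord a u • (a : X) + (u - ∑ a ∈ s, atomCoord a u • (a : X)))
            ⊓ |x - y| := by rw [add_sub_cancel, inf_comm]
      _ ≤ (∑ a ∈ s, atomCoord a u • (a : X)) ⊓ |x - y|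
          + (u - ∑ a ∈ s, atomCoord a u • (a : X)) ⊓ |x - y| :=
          add_inf_le_inf_add_inf (Finset.sum_nonneg fun a _ => hunn a) hr (abs_nonneg _)
      _ ≤ ∑ a ∈ s, |atomCoord a x - f a| • (a : X) +
            (u - ∑ a ∈ s, atomCoord a u • (a : X)) := by
          refine add_le_add ((sum_inf_le_sum_inf hunn (abs_nonneg _) s).trans
            (Finset.sum_le_sum fun a _ => ?_)) inf_le_left
          obtain ⟨-, hxa, hxd⟩ := atomCoord_spec a hx.1
          rw [inf_comm]
          exact abs_sub_inf_smul_le (unitAtoms_nonneg a) (atomCoord_spec a hu).1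
            (sub_nonneg.2 hxa) hxd (sub_nonneg.2 (le_hasSum hy a fun c _ => hnn c))
            (hy.sub_smul_inf_unitAtom_eq_zero hf0 a)
  calc ‖|x - y| ⊓ u‖
      ≤ ‖∑ a ∈ s, |atomCoord a x - f a| • (a : X) +
          (u - ∑ a ∈ s, atomCoord a u • (a : X))‖ :=
        norm_le_norm_of_nonneg_of_le (le_inf (abs_nonneg _) hu) key
    _ ≤ ∑ a ∈ s, |atomCoord a x - f a| + ‖u - ∑ a ∈ s, atomCoord a u • (a : X)‖ := by
        refine (norm_add_le _ _).trans (add_le_add_left ((norm_sum_le _ _).trans_eq ?_) _)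
        refine Finset.sum_congr rfl fun a _ => ?_
        rw [norm_smul, a.2.2, mul_one, Real.norm_eq_abs, abs_abs]
    _ < ε := by linarith

theorem UnSpace.isCompact_nonneg_norm_le (hatomic : IsAtomicLattice X) (hKB : IsKBSpace X)
    (C : ℝ) : IsCompact (X := UnSpace X) {x : X | 0 ≤ x ∧ ‖x‖ ≤ C} := by
  rw [isCompact_iff_ultrafilter_le_nhds]
  exact fun F hF => Ultrafilter.exists_le_nhds_unTopology hatomic hKB (le_principal_iff.1 hF)

theorem UnSpace.sigmaCompactSpace (hatomic : IsAtomicLattice X) (hKB : IsKBSpace X) :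
    SigmaCompactSpace (UnSpace X) := by
  let K : ℕ → Set (UnSpace X) := fun n => {x : X | 0 ≤ x ∧ ‖x‖ ≤ n}
  have hK (n : ℕ) : IsCompact (K n) := UnSpace.isCompact_nonneg_norm_le hatomic hKB n
  refine ⟨⟨fun n => (fun p : UnSpace X × UnSpace X => p.1 - p.2) '' (K n ×ˢ K n),
    fun n => ((hK n).prod (hK n)).image (continuous_fst.sub continuous_snd), ?_⟩⟩
  refine iUnion_eq_univ_iff.2 fun (x : X) => ?_
  obtain ⟨n, hn⟩ := exists_nat_ge ‖x‖
  have h1 : ‖x⁺‖ ≤ ‖x‖ := norm_le_norm_of_abs_le_abs (by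
    rw [abs_of_nonneg (posPart_nonneg x)]; exact sup_le (le_abs_self x) (abs_nonneg x))
  have h2 : ‖x⁻‖ ≤ ‖x‖ := norm_le_norm_of_abs_le_abs (by
    rw [abs_of_nonneg (negPart_nonneg x)]; exact sup_le (neg_le_abs x) (abs_nonneg x))
  exact ⟨n, ((x⁺ : X), (x⁻ : X)), ⟨⟨posPart_nonneg (α := X) x, h1.trans hn⟩,
    negPart_nonneg (α := X) x, h2.trans hn⟩, posPart_sub_negPart (α := X) x⟩

end UnSpace

theorem mainTheorem5 {X : Type*} [NormedAddCommGroup X] [NormedSpace ℝ X] [Lattice X]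
    [IsOrderedAddMonoid X] [IsOrderedModule ℝ X] [HasSolidNorm X] [CompleteSpace X]
    (hatomic : IsAtomicLattice X) (hKB : IsKBSpace X) :
    T2Space (UnSpace X) ∧
    (∀ (ι : Type*) (U : ι → Set (UnSpace X)), (∀ i, IsOpen (U i)) → (⋃ i, U i) = Set.univ →
      ∃ f : PartitionOfUnity ι (UnSpace X), f.IsSubordinate U) ∧
    ParacompactSpace (UnSpace X) ∧
    NormalSpace (UnSpace X) := by
  have : T2Space (UnSpace X) := t2Space_unTopology (X := X)
  have : SigmaCompactSpace (UnSpace X) := UnSpace.sigmaCompactSpace hatomic hKB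
  have : ParacompactSpace (UnSpace X) := paracompactSpace_of_regularSpace_of_lindelofSpace _
  have : NormalSpace (UnSpace X) := inferInstance
  exact ⟨inferInstance, fun ι U hU hcov =>
    PartitionOfUnity.exists_isSubordinate isClosed_univ U hU hcov.ge, inferInstance, inferInstance⟩
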